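/- Let $X,Y$ be Banach spaces, $1\le p,q<\infty$, and for a Banach space $E$ and $1\le r<\infty$ let $L^r_{loc}(\mathbb R,E)$ be the space of functions $u:\mathbb R\to E$ that are $r$-integrable in the sense of Bochner on every bounded interval (functions equal almost everywhere being identified). For $u\in L^r_{loc}(\mathbb R,E)$ let $u^b:\mathbb R\to L^r(0,1;E)$, $u^b(t)(\theta)=u(t+\theta)$, be its Bochner transform. Let $S^r_{ap}(\mathbb R,E)$ (resp. $S^r_{aa}(\mathbb R,E)$) be the set of $u\in L^r_{loc}(\mathbb R,E)$ such that $u^b$ is almost periodic in the sense of Bohr (resp. almost automorphic), with the norm $\|u\|_{S^r}=\sup_{t\in\mathbb R}\|u^b(t)\|_{L^r(0,1;E)}$. Here a continuous $v:\mathbb R\to Z$ into a Banach space $Z$ is almost periodic if for every $\varepsilon>0$ there is $\ell>0$ such that every interval $[\alpha,\alpha+\ell]$ contains some $\tau$ with $\sup_{t}\|v(t+\tau)-v(t)\|\le\varepsilon$; it is almost automorphic if every real sequence has a subsequence $(t_k)$ for which there is a function $w:\mathbb R\to Z$ with $v(t+t_k)\to w(t)$ and $w(t-t_k)\to v(t)$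 for every $t\in\mathbb R$. Let $f:\mathbb R\times X\to Y$ be a map, and let $\mathcal N_f(u)(t)=f(t,u(t))$ for $t\in\mathbb R$. For compact $K\subset X$ let $C(K,Y)$ be the Banach space of continuous maps $K\to Y$ with the supremum norm, and let $\tilde f_K:\mathbb R\to C(K,Y)$ be given by $\tilde f_K(t)=f(t,\cdot)|_K$ for a.e. $t\in\mathbb R$; the statement that $\tilde f_K$ belongs to a space of functions $\mathbb R\to C(K,Y)$ includes that $f(t,\cdot)|_K$ is continuous for a.e. $t$. Suppose that **(H1)** holds: there are a constant $a>0$ and a function $b\in S^q_{aa}(\mathbb R,\mathbb R)$ such that, for every $x\in X$, $$\|f(t,x)\|\le a\|x\|^{p/q}+b(t)\qquad\text{for a.e. }t\in\mathbb R .$$ i) If $\tilde f_K\in S^q_{aa}(\mathbb R,C(K,Y))$ for every compact set $K\subset X$, then $\mathcal N_f$ maps $S^p_{aa}(\mathbb R,X)$ into $S^q_{aa}(\mathbb R,Y)$ and $\mathcal N_f:S^p_{aa}(\mathbb R,X)\to S^q_{aa}(\mathbb R,Y)$ is continuous. ii) If $\tilde f_K\in S^q_{ap}(\mathbb R,C(K,Y))$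 for every compact set $K\subset X$, then $\mathcal N_f$ maps $S^p_{ap}(\mathbb R,X)$ into $S^q_{ap}(\mathbb R,Y)$ and $\mathcal N_f:S^p_{ap}(\mathbb R,X)\to S^q_{ap}(\mathbb R,Y)$ is continuous. -/

import Mathlib

open MeasureTheory Set Filter Topology
open scoped ENNReal

namespace Stepanov

/-- Lebesgue measure on the open unit interval `(0,1)`. -/
noncomputable abbrev unitMeasure : Measure ℝ := volume.restrict (Ioo (0 : ℝ) 1)

/-- `L^p_loc(ℝ, X)`: functions `ℝ → X` whose restriction to every bounded open interval `(a,b)`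
is strongly measurable (up to null sets) and `p`-integrable in the sense of Bochner. -/
structure LpLoc (p : ℝ≥0∞) (X : Type*) [NormedAddCommGroup X] where
  /-- the underlying function -/
  toFun : ℝ → X
  memLp : ∀ a b : ℝ, MemLp toFun p (volume.restrict (Ioo a b))

instance (p : ℝ≥0∞) (X : Type*) [NormedAddCommGroup X] : CoeFun (LpLoc p X) (fun _ => ℝ → X) :=
  ⟨LpLoc.toFun⟩

theorem LpLoc.memLp_translate {p : ℝ≥0∞} {X : Type*} [NormedAddCommGroup X] (u : LpLoc p X)
    (t : ℝ) : MemLp (fun θ => u (t + θ)) p unitMeasure := by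
  have h := (measurePreserving_add_left (volume : Measure ℝ) t).restrict_preimage
    (measurableSet_Ioo (a := t) (b := t + 1))
  have e : (fun x => t + x) ⁻¹' Ioo t (t + 1) = Ioo (0 : ℝ) 1 := by
    ext x; simp
  rw [e] at h
  exact (u.memLp t (t + 1)).comp_measurePreserving h

/-- The Bochner transform `u^b : ℝ → L^p(0,1;X)`, `u^b(t)(θ) = u(t + θ)`. -/
noncomputable def LpLoc.bochner {p : ℝ≥0∞} {X : Type*} [NormedAddCommGroup X] (u : LpLoc p X)
    (t : ℝ) : Lp X p unitMeasure :=
  (u.memLp_translate t).toLp (fun θ => u (t + θ))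

/-- The Stepanov distance `sup_t ‖u^b(t) - v^b(t)‖_{L^p}`, that is `‖u - v‖_{S^p}`
(with value `∞` if `u - v` is not Stepanov bounded). Two functions are at distance zero exactly
when they are equal almost everywhere. -/
noncomputable instance (p : ℝ≥0∞) [Fact (1 ≤ p)] (X : Type*) [NormedAddCommGroup X] :
    PseudoEMetricSpace (LpLoc p X) where
  edist u v := ⨆ t : ℝ, edist (u.bochner t) (v.bochner t)
  edist_self u := by simp
  edist_comm u v := by simp only [edist_comm]
  edist_triangle u v w := by
    refine iSup_le fun t => (edist_triangle _ (v.bochner t) _).trans ?_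
    exact add_le_add (le_iSup (fun t => edist (u.bochner t) (v.bochner t)) t)
      (le_iSup (fun t => edist (v.bochner t) (w.bochner t)) t)

/-- A subset of `ℝ` is relatively dense if it meets every interval of some fixed length. -/
def RelativelyDense (D : Set ℝ) : Prop :=
  ∃ l : ℝ, 0 < l ∧ ∀ α : ℝ, (D ∩ Icc α (α + l)).Nonempty

/-- Almost periodicity in the sense of Bohr. -/
def AlmostPeriodic {E : Type*} [NormedAddCommGroup E] (u : ℝ → E) : Prop :=
  Continuous u ∧
    ∀ ε : ℝ, 0 < ε → RelativelyDense {τ : ℝ | ∀ t : ℝ, ‖u (t + τ) - u t‖ ≤ ε}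

/-- Almost automorphy in the sense of Bochner. -/
def AlmostAutomorphic {E : Type*} [NormedAddCommGroup E] (u : ℝ → E) : Prop :=
  Continuous u ∧
    ∀ s : ℕ → ℝ, ∃ φ : ℕ → ℕ, StrictMono φ ∧ ∃ v : ℝ → E, ∀ t : ℝ,
      Tendsto (fun k => u (t + s (φ k))) atTop (𝓝 (v t)) ∧
      Tendsto (fun k => v (t - s (φ k))) atTop (𝓝 (u t))

/-- `S^p_aa(ℝ, X)`: the Bochner transform is almost automorphic. -/
def Saa (p : ℝ≥0∞) [Fact (1 ≤ p)] (X : Type*) [NormedAddCommGroup X] : Set (LpLoc p X) :=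
  {u | AlmostAutomorphic u.bochner}

/-- `S^p_ap(ℝ, X)`: the Bochner transform is almost periodic. -/
def Sap (p : ℝ≥0∞) [Fact (1 ≤ p)] (X : Type*) [NormedAddCommGroup X] : Set (LpLoc p X) :=
  {u | AlmostPeriodic u.bochner}

/-- The Nemytskii (superposition) operator of `f` on functions: `t ↦ f(t, u(t))`. -/
def nemytskii {X Y : Type*} (f : ℝ → X → Y) (u : ℝ → X) : ℝ → Y := fun t => f t (u t)

/-- The Nemytskii operator of `f` maps the set `A ⊆ L^p_loc(ℝ,X)` into the set
`B ⊆ L^q_loc(ℝ,Y)` and is continuous for the Stepanov distances. -/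
def NemytskiiMapsContinuously {p q : ℝ≥0∞} [Fact (1 ≤ p)] [Fact (1 ≤ q)]
    {X Y : Type*} [NormedAddCommGroup X] [NormedAddCommGroup Y]
    (f : ℝ → X → Y) (A : Set (LpLoc p X)) (B : Set (LpLoc q Y)) : Prop :=
  ∃ N : A → B, (∀ u : A, (N u : LpLoc q Y).toFun = nemytskii f (u : LpLoc p X)) ∧ Continuous N

/-- `f̃_K : ℝ → C(K,Y)`, `f̃_K(t) = f(t,·)` for a.e. `t`, belongs to the given set `S` of functions
(in particular `f(t,·)` is continuous on `K` for a.e. `t`). -/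
def SliceMem {q : ℝ≥0∞} {X Y : Type*} [NormedAddCommGroup X] [NormedAddCommGroup Y]
    (f : ℝ → X → Y) (K : TopologicalSpace.Compacts X) (S : Set (LpLoc q C(K, Y))) : Prop :=
  ∃ g ∈ S, ∀ᵐ t : ℝ, ∀ x : K, g.toFun t x = f t x

end Stepanov

/-! Everything rests on one estimate for pairs of times. If `u^b(τ)` is close to `u^b(σ)`, and the
Bochner transforms of the slices of `f` on suitable compact sets `K n` are close at `τ` and `σ`,
then the transform of `f(·, u(·))` is close at `τ` and `σ`.

Both kinds of recurrence make the Bochner transforms have totally bounded range. In `L^p` with `p`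
finite this gives tightness (values lie in one compact set off a set of small measure) and uniformly
absolutely continuous norms. The estimate, `tendsto_eLpNorm_superposition_sub`, is then of Vitali
type. Off a small set the slices lie in a compact `Q ⊆ C(K n, Y)` and the arguments in `K n`, and
evaluation is uniformly continuous on `Q × K n`. On the small set the growth bound applies.

Recurrence is expressed through filters on pairs of times. By Bochner's criterion, almost
periodicity of a continuous function means `translationFilter ≤ timeUniformity v`. Almost automorphy
gives `AutomorphicAlong` for a subsequence of any sequence. Both properties pass to countable
infima, the second after a diagonal extraction, so the pairwise estimate carries them from `u` and
the slices to the superposition. Continuity is the same estimate with `τ = σ`, along times where the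
supremum is nearly detected. -/

namespace Stepanov

/-! ### Tightness and uniform integrability of totally bounded sets in `L^p` -/

section Compactness

variable {α : Type*} [MeasurableSpace α] {μ : Measure α} {E : Type*} [NormedAddCommGroup E]
  {p : ℝ≥0∞}

/-- A quantitative form of the fact that convergence in `L^p` implies convergence in measure. -/
theorem exists_measure_enorm_ge_le_of_eLpNorm_le (hp0 : p ≠ 0) (hp : p ≠ ∞) {ρ δ : ℝ≥0∞}
    (hρ : ρ ≠ 0) (hρ' : ρ ≠ ∞) (hδ : δ ≠ 0) :
    ∃ ε : ℝ≥0∞, ε ≠ 0 ∧ ∀ f : α → E, AEStronglyMeasurable f μ → eLpNorm f p μ ≤ ε →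
      μ {x | ρ ≤ ‖f x‖ₑ} ≤ δ := by
  have hpos : 0 < p.toReal := ENNReal.toReal_pos hp0 hp
  have h : Tendsto (fun x : ℝ≥0∞ => ρ⁻¹ ^ p.toReal * x ^ p.toReal) (𝓝 0) (𝓝 0) := by
    have h1 : Tendsto (fun x : ℝ≥0∞ => x ^ p.toReal) (𝓝 0) (𝓝 0) := by
      simpa [ENNReal.zero_rpow_of_pos hpos] using
        (ENNReal.continuous_rpow_const (y := p.toReal)).tendsto 0
    simpa using ENNReal.Tendsto.const_mul (a := ρ⁻¹ ^ p.toReal) h1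
      (Or.inr (ENNReal.rpow_ne_top_of_nonneg hpos.le (by simpa using hρ)))
  have h2 := h.eventually (Iic_mem_nhds (pos_iff_ne_zero.2 hδ))
  obtain ⟨ε, hε, hle⟩ := ENNReal.nhds_zero_basis_Iic.eventually_iff.1 h2
  refine ⟨ε, hε.ne', fun f hf hfε => ?_⟩
  refine (meas_ge_le_mul_pow_eLpNorm_enorm μ hp0 hp hf hρ fun h => (hρ' h).elim).trans ?_
  exact hle hfε

/-- The elements of a totally bounded subset of `L^p` are, outside a set of small measure, close
to a common finite set. -/
theorem exists_finite_measure_notMem_le [Fact (1 ≤ p)] (hp : p ≠ ∞) {S : Set (Lp E p μ)}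
    (hS : TotallyBounded S) {ρ : ℝ} (hρ : 0 < ρ) {δ : ℝ≥0∞} (hδ : δ ≠ 0) :
    ∃ C : Set E, C.Finite ∧ ∀ v ∈ S, μ {x | v x ∉ ⋃ c ∈ C, Metric.closedBall c ρ} ≤ δ := by
  have hp1 : (1 : ℝ≥0∞) ≤ p := Fact.out
  have hp0 : p ≠ 0 := (zero_lt_one.trans_le hp1).ne'
  obtain ⟨ε, hε, h⟩ := exists_measure_enorm_ge_le_of_eLpNorm_le (μ := μ) (E := E) hp0 hp
    (ρ := ENNReal.ofReal ρ) (by simpa using hρ) (by simp) hδ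
  have hε2 : ε / 2 ≠ 0 := (ENNReal.half_pos hε).ne'
  obtain ⟨t, ht, hSt⟩ := EMetric.totallyBounded_iff.1 hS (ε / 2) (pos_iff_ne_zero.2 hε2)
  -- Simple functions have finite range, so approximating a finite net by them produces the finite
  -- set of centres.
  choose g hg _ using fun w : Lp E p μ =>
    (Lp.memLp w).exists_simpleFunc_eLpNorm_sub_lt hp hε2
  refine ⟨⋃ w ∈ t, range (g w), ht.biUnion fun w _ => (g w).finite_range, fun v hv => ?_⟩
  obtain ⟨w, hw, hvw⟩ := mem_iUnion₂.1 (hSt hv)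
  rw [Metric.mem_eball, Lp.edist_def] at hvw
  have hm1 : AEStronglyMeasurable (⇑v - ⇑w) μ :=
    (Lp.aestronglyMeasurable v).sub (Lp.aestronglyMeasurable w)
  have hm2 : AEStronglyMeasurable (⇑w - ⇑(g w)) μ :=
    (Lp.aestronglyMeasurable w).sub (g w).aestronglyMeasurable
  have hle : eLpNorm (⇑v - ⇑(g w)) p μ ≤ ε := by
    have := eLpNorm_add_le hm1 hm2 hp1
    rw [sub_add_sub_cancel] at this
    refine this.trans ((add_le_add hvw.le (hg w).le).trans_eq (ENNReal.add_halves ε))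
  refine (measure_mono fun x hx => ?_).trans
    (h _ ((Lp.aestronglyMeasurable v).sub (g w).aestronglyMeasurable) hle)
  by_contra hlt
  refine hx (mem_iUnion₂.2 ⟨g w x, mem_iUnion₂.2 ⟨w, hw, mem_range_self x⟩, ?_⟩)
  simp only [mem_ofPred_eq, not_le, Pi.sub_apply] at hlt
  rw [Metric.mem_closedBall, dist_eq_norm]
  rw [← ofReal_norm] at hlt
  exact ((ENNReal.ofReal_lt_ofReal_iff hρ).1 hlt).le

/-- A totally bounded subset of `L^p` is tight. -/
theorem exists_isCompact_measure_notMem_le [CompleteSpace E] [Fact (1 ≤ p)] (hp : p ≠ ∞)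
    {S : Set (Lp E p μ)} (hS : TotallyBounded S) {δ : ℝ≥0∞} (hδ : δ ≠ 0) :
    ∃ K : Set E, IsCompact K ∧ ∀ v ∈ S, μ {x | v x ∉ K} ≤ δ := by
  obtain ⟨d, hd, hsum⟩ := ENNReal.exists_pos_sum_of_countable' hδ ℕ
  choose C hC hCS using fun n : ℕ => exists_finite_measure_notMem_le hp hS
    (ρ := 1 / ((n : ℝ) + 1)) Nat.one_div_pos_of_nat (hd n).ne'
  -- This set is closed and has finite nets at every scale, hence is compact by completeness; the
  -- exceptional measures `d n` sum to less than `δ`.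
  refine ⟨⋂ n, ⋃ c ∈ C n, Metric.closedBall c (1 / ((n : ℝ) + 1)), ?_, fun v hv => ?_⟩
  · refine isCompact_iff_totallyBounded_isComplete.2 ⟨?_, IsClosed.isComplete ?_⟩
    · refine Metric.totallyBounded_iff.2 fun ε hε => ?_
      obtain ⟨n, hn⟩ := exists_nat_one_div_lt hε
      refine ⟨C n, hC n, fun x hx => ?_⟩
      obtain ⟨c, hc, hxc⟩ := mem_iUnion₂.1 (mem_iInter.1 hx n)
      exact mem_iUnion₂.2 ⟨c, hc, (Metric.mem_closedBall.1 hxc).trans_lt hn⟩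
    · exact isClosed_iInter fun n => (hC n).isClosed_biUnion fun c _ => Metric.isClosed_closedBall
  · have : {x | v x ∉ ⋂ n, ⋃ c ∈ C n, Metric.closedBall c (1 / ((n : ℝ) + 1))} =
        ⋃ n, {x | v x ∉ ⋃ c ∈ C n, Metric.closedBall c (1 / ((n : ℝ) + 1))} := by
      ext x
      simp only [mem_iInter, mem_ofPred_eq, not_forall, mem_iUnion (s := fun n : ℕ =>
        {x | v x ∉ ⋃ c ∈ C n, Metric.closedBall c (1 / ((n : ℝ) + 1))})]
    rw [this]
    exact (measure_iUnion_le _).trans ((ENNReal.tsum_le_tsum fun n => hCS n v hv).trans hsum.le)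

/-- A totally bounded subset of `L^p` has uniformly absolutely continuous norms. -/
theorem exists_eLpNorm_indicator_le_of_totallyBounded [Fact (1 ≤ p)] (hp : p ≠ ∞)
    {S : Set (Lp E p μ)} (hS : TotallyBounded S) {ε : ℝ≥0∞} (hε : ε ≠ 0) :
    ∃ δ : ℝ≥0∞, δ ≠ 0 ∧ ∀ v ∈ S, ∀ s, MeasurableSet s → μ s ≤ δ →
      eLpNorm (s.indicator v) p μ ≤ ε := by
  have hp1 : (1 : ℝ≥0∞) ≤ p := Fact.out
  rcases eq_or_ne ε ∞ with rfl | hε'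
  · exact ⟨1, one_ne_zero, fun _ _ _ _ _ => le_top⟩
  have hε2 : ε / 2 ≠ 0 := (ENNReal.half_pos hε).ne'
  have hε2' : ε / 2 ≠ ∞ := ENNReal.div_ne_top hε' two_ne_zero
  obtain ⟨t, ht, hSt⟩ := EMetric.totallyBounded_iff.1 hS (ε / 2) (pos_iff_ne_zero.2 hε2)
  have : Finite t := ht
  obtain ⟨δ, hδ, h⟩ := unifIntegrable_finite (μ := μ) hp1 hp (f := fun w : t => ((w : Lp E p μ) : α → E))
    (fun w => Lp.memLp _) (ENNReal.toReal_pos hε2 hε2')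
  rw [ENNReal.ofReal_toReal hε2'] at h
  refine ⟨ENNReal.ofReal δ, by simpa using hδ, fun v hv s hs hsδ => ?_⟩
  obtain ⟨w, hw, hvw⟩ := mem_iUnion₂.1 (hSt hv)
  rw [Metric.mem_eball, Lp.edist_def] at hvw
  have e : s.indicator (v : α → E) = s.indicator (⇑v - ⇑w) + s.indicator ⇑w := by
    rw [← indicator_add']; simp
  rw [e]
  refine (eLpNorm_add_le (((Lp.aestronglyMeasurable v).sub (Lp.aestronglyMeasurable w)).indicator hs)
    ((Lp.aestronglyMeasurable w).indicator hs) hp1).trans ?_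
  refine (add_le_add ((eLpNorm_indicator_le _).trans hvw.le) (h ⟨w, hw⟩ s hs hsδ)).trans_eq
    (ENNReal.add_halves ε)

end Compactness

/-! ### Measurability and growth of superpositions -/

section Superposition

variable {α : Type*} [MeasurableSpace α] {μ : Measure α} {X Y : Type*} [NormedAddCommGroup X]
  [NormedAddCommGroup Y]

/-- Evaluation along a measurable function with values in a compact set is measurable. -/
theorem aestronglyMeasurable_eval_of_mem {K : TopologicalSpace.Compacts X} {F : α → X → Y}
    {G : α → C(K, Y)} (hG : AEStronglyMeasurable G μ) (hGF : ∀ᵐ t ∂μ, ∀ x : K, G t x = F t x)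
    {U : α → X} (hU : AEStronglyMeasurable U μ) (hUK : ∀ᵐ t ∂μ, U t ∈ K) :
    AEStronglyMeasurable (fun t => F t (U t)) μ := by
  classical
  rcases isEmpty_or_nonempty K with hK | ⟨⟨x₀⟩⟩
  · have : μ = 0 := by
      rw [← ae_eq_bot, ← Filter.eventually_false_iff_eq_bot]
      filter_upwards [hUK] with t ht using hK.elim ⟨U t, ht⟩
    simp [this]
  · let V : α → K := fun t => if h : U t ∈ K then ⟨U t, h⟩ else x₀
    have hV : ∀ᵐ t ∂μ, (V t : X) = U t := by
      filter_upwards [hUK] with t ht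
      simp [V, ht]
    have hVm : AEStronglyMeasurable V μ := by
      rw [← (Topology.IsEmbedding.subtypeVal (p := (· ∈ K))).aestronglyMeasurable_comp_iff]
      exact hU.congr (hV.mono fun t ht => ht.symm)
    have hc : Continuous fun z : C(K, Y) × K => z.1 z.2 := continuous_eval
    refine (hc.comp_aestronglyMeasurable (hG.prodMk hVm)).congr ?_
    filter_upwards [hV, hGF] with t h1 h2
    simp only [h2, h1]

/-- A growth estimate that holds almost everywhere at each point holds almost everywhere on a
compact set on which `F` is almost everywhere continuous. -/
theorem ae_forall_mem_norm_le {K : TopologicalSpace.Compacts X} {F : α → X → Y}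
    {G : α → C(K, Y)} (hGF : ∀ᵐ t ∂μ, ∀ x : K, G t x = F t x) {a r : ℝ} (hr : 0 ≤ r) {B : α → ℝ}
    (hB : ∀ x, ∀ᵐ t ∂μ, ‖F t x‖ ≤ a * ‖x‖ ^ r + B t) :
    ∀ᵐ t ∂μ, ∀ x ∈ K, ‖F t x‖ ≤ a * ‖x‖ ^ r + B t := by
  -- The null set in `hB` depends on `x`. A countable dense set merges these null sets, and
  -- continuity of the slice extends the bound to all of `K`.
  obtain ⟨D, hDc, hDd⟩ := TopologicalSpace.exists_countable_dense K
  have h1 : ∀ᵐ t ∂μ, ∀ x ∈ D, ‖F t x‖ ≤ a * ‖(x : X)‖ ^ r + B t :=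
    (ae_ball_iff hDc).2 fun x _ => hB x
  filter_upwards [hGF, h1] with t h2 h3 x hx
  have hcl : IsClosed {x : K | ‖G t x‖ ≤ a * ‖(x : X)‖ ^ r + B t} := by
    refine isClosed_le (by fun_prop) ?_
    refine (continuous_const.mul ?_).add continuous_const
    exact (continuous_norm.comp continuous_subtype_val).rpow_const fun _ => Or.inr hr
  have h4 : D ⊆ {x : K | ‖G t x‖ ≤ a * ‖(x : X)‖ ^ r + B t} := fun x hx => by
    simpa [h2] using h3 x hx
  simpa [h2] using hcl.closure_subset_iff.2 h4 (hDd ⟨x, hx⟩)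

variable [CompleteSpace X]

/-- A superposition `t ↦ F t (U t)` is measurable and inherits the growth of `F` if `F` has
measurable slices on compact sets. -/
theorem aestronglyMeasurable_superposition {p : ℝ≥0∞} [Fact (1 ≤ p)] (hp : p ≠ ∞) {F : α → X → Y}
    (hF : ∀ K : TopologicalSpace.Compacts X, ∃ G : α → C(K, Y), AEStronglyMeasurable G μ ∧
      ∀ᵐ t ∂μ, ∀ x : K, G t x = F t x)
    {a r : ℝ} (hr : 0 ≤ r) {B : α → ℝ} (hB : ∀ x, ∀ᵐ t ∂μ, ‖F t x‖ ≤ a * ‖x‖ ^ r + B t)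
    {U : α → X} (hU : MemLp U p μ) :
    AEStronglyMeasurable (fun t => F t (U t)) μ ∧
      ∀ᵐ t ∂μ, ‖F t (U t)‖ ≤ a * ‖U t‖ ^ r + B t := by
  -- Tightness of the single function `U`: countably many compact sets capture almost all its
  -- values, so both claims can be checked on one compact set at a time.
  have key : ∀ n : ℕ, ∃ K : TopologicalSpace.Compacts X,
      μ {t | U t ∉ K} ≤ ((n : ℝ≥0∞) + 1)⁻¹ := by
    intro n
    obtain ⟨K, hK, h⟩ := exists_isCompact_measure_notMem_le (μ := μ) hp
      (S := {hU.toLp U}) (Set.finite_singleton _).totallyBounded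
      (δ := ((n : ℝ≥0∞) + 1)⁻¹) (by simp)
    refine ⟨⟨K, hK⟩, (measure_mono_ae ?_).trans (h _ rfl)⟩
    filter_upwards [hU.coeFn_toLp] with t ht h'
    change hU.toLp U t ∉ K
    rw [ht]; exact h'
  choose K hK using key
  have hcov : ∀ᵐ t ∂μ, ∃ n, U t ∈ K n := by
    rw [ae_iff]
    refine le_antisymm (ENNReal.le_of_forall_pos_le_add fun ε hε _ => ?_) zero_le
    obtain ⟨n, hn⟩ := ENNReal.exists_inv_nat_lt (a := (ε : ℝ≥0∞)) (by simpa using hε.ne')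
    rw [zero_add]
    refine (measure_mono fun t ht => ?_).trans ((hK n).trans (le_trans ?_ hn.le))
    · exact fun h => ht ⟨n, h⟩
    · exact ENNReal.inv_le_inv.2 le_self_add
  choose G hGm hGF using fun n => hF (K n)
  constructor
  · borelize X
    let U' := hU.1.mk U
    have hU'm : StronglyMeasurable U' := hU.1.stronglyMeasurable_mk
    have hUU' : U =ᵐ[μ] U' := hU.1.ae_eq_mk
    let A : ℕ → Set α := fun n => U' ⁻¹' (K n)
    have hA : ∀ n, MeasurableSet (A n) := fun n =>
      hU'm.measurable (K n).isCompact.isClosed.measurableSet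
    have hAu : μ.restrict (⋃ n, A n) = μ := by
      refine Measure.restrict_eq_self_of_ae_mem ?_
      filter_upwards [hcov, hUU'] with t ⟨n, hn⟩ h
      exact mem_iUnion.2 ⟨n, by change U' t ∈ K n; rwa [← h]⟩
    rw [← hAu, aestronglyMeasurable_iUnion_iff]
    intro n
    refine aestronglyMeasurable_eval_of_mem (hGm n).restrict (ae_restrict_of_ae (hGF n))
      hU.1.restrict ?_
    filter_upwards [ae_restrict_of_ae hUU', ae_restrict_mem (hA n)] with t h1 h2
    rw [h1]; exact h2
  · have := ae_all_iff.2 fun n => ae_forall_mem_norm_le (hGF n) hr hB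
    filter_upwards [this, hcov] with t h ⟨n, hn⟩
    exact h n _ hn

end Superposition

/-! ### Superpositions of translates and the main estimate -/

/-- The elements of `L^p_loc` whose Bochner transform has a totally bounded range. -/
def PrecompactRange (p : ℝ≥0∞) [Fact (1 ≤ p)] (E : Type*) [NormedAddCommGroup E] :
    Set (LpLoc p E) :=
  {u | TotallyBounded (range u.bochner)}

instance : IsProbabilityMeasure unitMeasure := ⟨by simp⟩

theorem ae_unitMeasure_add {P : ℝ → Prop} (h : ∀ᵐ t, P t) (τ : ℝ) :
    ∀ᵐ θ ∂unitMeasure, P (τ + θ) :=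
  ae_restrict_of_ae ((measurePreserving_add_left volume τ).quasiMeasurePreserving.ae h)

theorem LpLoc.coeFn_bochner {p : ℝ≥0∞} {E : Type*} [NormedAddCommGroup E] (u : LpLoc p E)
    (t : ℝ) : u.bochner t =ᵐ[unitMeasure] fun θ => u (t + θ) :=
  (u.memLp_translate t).coeFn_toLp

section Superposition

variable {X Y : Type*} [NormedAddCommGroup X] [NormedAddCommGroup Y] {p q : ℝ≥0∞}
  [Fact (1 ≤ p)] [Fact (1 ≤ q)] {f : ℝ → X → Y} {a : ℝ} {b : LpLoc q ℝ}

theorem toReal_pos_of_fact (hp : p ≠ ∞) : 0 < p.toReal :=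
  ENNReal.toReal_pos (zero_lt_one.trans_le (Fact.out : (1 : ℝ≥0∞) ≤ p)).ne' hp

theorem eLpNorm_norm_rpow_div (hp : p ≠ ∞) (hq : q ≠ ∞) {α : Type*} [MeasurableSpace α]
    (μ : Measure α) (U : α → X) :
    eLpNorm (fun t => ‖U t‖ ^ (p.toReal / q.toReal)) q μ =
      eLpNorm U p μ ^ (p.toReal / q.toReal) := by
  have h1 := toReal_pos_of_fact hp
  have h2 := toReal_pos_of_fact hq
  rw [eLpNorm_norm_rpow U (div_pos h1 h2)]
  congr 2
  rw [ENNReal.ofReal_div_of_pos h2, ENNReal.ofReal_toReal hp, ENNReal.ofReal_toReal hq]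
  exact ENNReal.mul_div_cancel (by rintro rfl; simp at h2) hq

/-- The superposition operator of a map of growth `‖x‖ ^ (p / q)` sends `L^p_loc` to `L^q_loc`. -/
theorem memLp_nemytskii [CompleteSpace X] (hp : p ≠ ∞) (hq : q ≠ ∞)
    (hf : ∀ K : TopologicalSpace.Compacts X, SliceMem (q := q) f K univ)
    (hb : ∀ x, ∀ᵐ t, ‖f t x‖ ≤ a * ‖x‖ ^ (p.toReal / q.toReal) + b t) (u : LpLoc p X) (c d : ℝ) :
    MemLp (nemytskii f u) q (volume.restrict (Ioo c d)) := by
  have h1 := toReal_pos_of_fact hp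
  have h2 := toReal_pos_of_fact hq
  have hF : ∀ K : TopologicalSpace.Compacts X, ∃ G : ℝ → C(K, Y),
      AEStronglyMeasurable G (volume.restrict (Ioo c d)) ∧
        ∀ᵐ t ∂volume.restrict (Ioo c d), ∀ x : K, G t x = f t x := fun K => by
    obtain ⟨g, -, hg⟩ := hf K
    exact ⟨g, (g.memLp c d).1, ae_restrict_of_ae hg⟩
  obtain ⟨hm, hle⟩ := aestronglyMeasurable_superposition (μ := volume.restrict (Ioo c d)) hp
    (F := f) hF (div_pos h1 h2).le (fun x => ae_restrict_of_ae (hb x)) (u.memLp c d)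
  refine MemLp.mono' (g := fun t => a * ‖u t‖ ^ (p.toReal / q.toReal) + b t) ?_ hm hle
  refine MemLp.add (MemLp.const_mul ⟨?_, ?_⟩ a) (b.memLp c d)
  · exact ((Real.continuous_rpow_const (div_pos h1 h2).le).comp
      continuous_norm).comp_aestronglyMeasurable (u.memLp c d).1
  · rw [eLpNorm_norm_rpow_div hp hq]
    exact ENNReal.rpow_lt_top_of_nonneg (div_pos h1 h2).le (u.memLp c d).2.ne

variable [CompleteSpace X]

theorem aestronglyMeasurable_translate_superposition (hp : p ≠ ∞) (hq : q ≠ ∞)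
    (hf : ∀ K : TopologicalSpace.Compacts X, SliceMem (q := q) f K univ)
    (hb : ∀ x, ∀ᵐ t, ‖f t x‖ ≤ a * ‖x‖ ^ (p.toReal / q.toReal) + b t)
    (τ : ℝ) (v : Lp X p unitMeasure) :
    AEStronglyMeasurable (fun θ => f (τ + θ) (v θ)) unitMeasure ∧
      ∀ᵐ θ ∂unitMeasure,
        ‖f (τ + θ) (v θ)‖ ≤ a * ‖v θ‖ ^ (p.toReal / q.toReal) + b.bochner τ θ := by
  refine aestronglyMeasurable_superposition hp (fun K => ?_)
    (div_pos (toReal_pos_of_fact hp) (toReal_pos_of_fact hq)).le (fun x => ?_) (Lp.memLp v)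
  · obtain ⟨g, -, hg⟩ := hf K
    exact ⟨_, (g.memLp_translate τ).1, ae_unitMeasure_add hg τ⟩
  · filter_upwards [ae_unitMeasure_add (hb x) τ, b.coeFn_bochner τ] with θ h1 h2
    rwa [h2]

/-- The superpositions of the translates of `f` with the elements of a totally bounded set have
uniformly absolutely continuous norms. -/
theorem exists_eLpNorm_indicator_superposition_le (hp : p ≠ ∞) (hq : q ≠ ∞)
    (hf : ∀ K : TopologicalSpace.Compacts X, SliceMem (q := q) f K univ)
    (hbr : b ∈ PrecompactRange q ℝ)
    (hb : ∀ x, ∀ᵐ t, ‖f t x‖ ≤ a * ‖x‖ ^ (p.toReal / q.toReal) + b t)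
    {S : Set (Lp X p unitMeasure)} (hS : TotallyBounded S) {ε : ℝ≥0∞} (hε : ε ≠ 0) :
    ∃ δ : ℝ≥0∞, δ ≠ 0 ∧ ∀ τ, ∀ v ∈ S, ∀ s, MeasurableSet s → unitMeasure s ≤ δ →
      eLpNorm (s.indicator fun θ => f (τ + θ) (v θ)) q unitMeasure ≤ ε := by
  set r := p.toReal / q.toReal with hr_def
  have hr : 0 < r := div_pos (toReal_pos_of_fact hp) (toReal_pos_of_fact hq)
  have hε2 : ε / 2 ≠ 0 := (ENNReal.half_pos hε).ne'
  have hq1 : (1 : ℝ≥0∞) ≤ q := Fact.out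
  have h : Tendsto (fun x : ℝ≥0∞ => ‖a‖ₑ * x ^ r) (𝓝 0) (𝓝 0) := by
    have h1 : Tendsto (fun x : ℝ≥0∞ => x ^ r) (𝓝 0) (𝓝 0) := by
      simpa [ENNReal.zero_rpow_of_pos hr] using (ENNReal.continuous_rpow_const (y := r)).tendsto 0
    simpa using ENNReal.Tendsto.const_mul (a := ‖a‖ₑ) h1 (Or.inr enorm_ne_top)
  obtain ⟨η, hη, hle⟩ := ENNReal.nhds_zero_basis_Iic.eventually_iff.1
    (h.eventually (Iic_mem_nhds (pos_iff_ne_zero.2 hε2)))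
  obtain ⟨δ₁, hδ₁, h₁⟩ := exists_eLpNorm_indicator_le_of_totallyBounded hp hS hη.ne'
  obtain ⟨δ₂, hδ₂, h₂⟩ := exists_eLpNorm_indicator_le_of_totallyBounded hq hbr hε2
  refine ⟨min δ₁ δ₂, (lt_min (pos_iff_ne_zero.2 hδ₁) (pos_iff_ne_zero.2 hδ₂)).ne',
    fun τ v hv s hs hsδ => ?_⟩
  have hbound := (aestronglyMeasurable_translate_superposition hp hq hf hb τ v).2
  have hv1 := (Lp.aestronglyMeasurable v).indicator hs
  calc eLpNorm (s.indicator fun θ => f (τ + θ) (v θ)) q unitMeasure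
      ≤ eLpNorm ((a • fun θ => ‖s.indicator v θ‖ ^ r) + s.indicator (b.bochner τ)) q
          unitMeasure := by
        refine eLpNorm_mono_ae ?_
        filter_upwards [hbound] with θ hθ
        by_cases h : θ ∈ s
        · simpa [h] using hθ.trans (le_abs_self _)
        · simp only [indicator_of_notMem h, norm_zero]
          exact norm_nonneg _
    _ ≤ eLpNorm (a • fun θ => ‖s.indicator v θ‖ ^ r) q unitMeasure +
          eLpNorm (s.indicator (b.bochner τ)) q unitMeasure := by
        refine eLpNorm_add_le (AEStronglyMeasurable.const_smul ?_ a)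
          ((Lp.aestronglyMeasurable _).indicator hs) hq1
        exact ((Real.continuous_rpow_const hr.le).comp
          continuous_norm).comp_aestronglyMeasurable hv1
    _ ≤ ε / 2 + ε / 2 := by
        refine add_le_add (eLpNorm_const_smul_le.trans ?_)
          (h₂ _ (mem_range_self τ) s hs (hsδ.trans (min_le_right _ _)))
        rw [eLpNorm_norm_rpow_div hp hq]
        exact hle (mem_Iic.2 (h₁ v hv s hs (hsδ.trans (min_le_left _ _))))
    _ = ε := ENNReal.add_halves ε

variable [CompleteSpace Y]

/-- Joint continuity of superpositions, uniform with respect to translations of the map `f`. -/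
theorem tendsto_eLpNorm_superposition_sub (hp : p ≠ ∞) (hq : q ≠ ∞)
    (hf : ∀ K : TopologicalSpace.Compacts X, SliceMem (q := q) f K univ)
    (hbr : b ∈ PrecompactRange q ℝ)
    (hb : ∀ x, ∀ᵐ t, ‖f t x‖ ≤ a * ‖x‖ ^ (p.toReal / q.toReal) + b t)
    {S : Set (Lp X p unitMeasure)} (hS : TotallyBounded S)
    {K : ℕ → TopologicalSpace.Compacts X}
    (hK : ∀ n : ℕ, ∀ v ∈ S, unitMeasure {θ | v θ ∉ K n} ≤ ((n : ℝ≥0∞) + 1)⁻¹)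
    {g : ∀ n, LpLoc q C(K n, Y)} (hgr : ∀ n, g n ∈ PrecompactRange q C(K n, Y))
    (hg : ∀ n, ∀ᵐ t, ∀ x : K n, (g n).toFun t x = f t x)
    {ι : Type*} {l : Filter ι} {τ σ : ι → ℝ} {U W : ι → Lp X p unitMeasure}
    (hU : ∀ i, U i ∈ S) (hW : ∀ i, W i ∈ S)
    (hUW : Tendsto (fun i => edist (U i) (W i)) l (𝓝 0))
    (hgg : ∀ n, Tendsto (fun i => edist ((g n).bochner (τ i)) ((g n).bochner (σ i))) l (𝓝 0)) :
    Tendsto (fun i => eLpNorm (fun θ => f (τ i + θ) (U i θ) - f (σ i + θ) (W i θ)) q unitMeasure)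
      l (𝓝 0) := by
  have hp1 : (1 : ℝ≥0∞) ≤ p := Fact.out
  have hq1 : (1 : ℝ≥0∞) ≤ q := Fact.out
  have hp0 : p ≠ 0 := (zero_lt_one.trans_le hp1).ne'
  have hq0 : q ≠ 0 := (zero_lt_one.trans_le hq1).ne'
  have hmeas := aestronglyMeasurable_translate_superposition (b := b) hp hq hf hb
  rw [ENNReal.tendsto_nhds_zero]
  intro ε' hε'
  obtain ⟨ε, hε, hεε'⟩ : ∃ ε : ℝ, 0 < ε ∧ ENNReal.ofReal ε * 3 ≤ ε' := by
    obtain ⟨x, hx0, hx⟩ := ENNReal.lt_iff_exists_nnreal_btwn.1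
      (ENNReal.div_pos hε'.ne' (by simp : (3 : ℝ≥0∞) ≠ ∞))
    refine ⟨x, by exact_mod_cast hx0, ?_⟩
    rw [ENNReal.ofReal_coe_nnreal]
    exact ((ENNReal.le_div_iff_mul_le (by simp) (by simp)).1 hx.le)
  obtain ⟨δ, hδ, hui⟩ := exists_eLpNorm_indicator_superposition_le hp hq hf hbr hb hS
    (ε := ENNReal.ofReal ε) (by simpa using hε)
  -- Six exceptional sets occur below: two for `K n`, two for `Q`, and two where the arguments or
  -- the slices differ by at least `ρ`.
  have hδ6 : δ / 6 ≠ 0 := (ENNReal.div_pos hδ (by simp)).ne'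
  obtain ⟨n, hn⟩ := ENNReal.exists_inv_nat_lt hδ6
  have hn' : ((n : ℝ≥0∞) + 1)⁻¹ ≤ δ / 6 := (ENNReal.inv_le_inv.2 le_self_add).trans hn.le
  obtain ⟨Q, hQ, hQg⟩ := exists_isCompact_measure_notMem_le hq (hgr n) hδ6
  have huc := (hQ.prod (isCompact_univ (X := K n))).uniformContinuousOn_of_continuous
    (f := fun z : C(K n, Y) × K n => z.1 z.2) continuous_eval.continuousOn
  obtain ⟨ρ, hρ, hρε⟩ := Metric.uniformContinuousOn_iff.1 huc ε hε
  obtain ⟨ε₁, hε₁, h₁⟩ := exists_measure_enorm_ge_le_of_eLpNorm_le (μ := unitMeasure) (E := X)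
    hp0 hp (ρ := ENNReal.ofReal ρ) (by simpa using hρ) (by simp) hδ6
  obtain ⟨ε₂, hε₂, h₂⟩ := exists_measure_enorm_ge_le_of_eLpNorm_le (μ := unitMeasure)
    (E := C(K n, Y)) hq0 hq (ρ := ENNReal.ofReal ρ) (by simpa using hρ) (by simp) hδ6
  filter_upwards [ENNReal.tendsto_nhds_zero.1 hUW ε₁ (pos_iff_ne_zero.2 hε₁),
    ENNReal.tendsto_nhds_zero.1 (hgg n) ε₂ (pos_iff_ne_zero.2 hε₂)] with i hi₁ hi₂
  rw [Lp.edist_def] at hi₁ hi₂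
  set G := (g n).bochner (τ i)
  set H := (g n).bochner (σ i)
  let bad : Set ℝ := ({θ | U i θ ∉ K n} ∪ {θ | W i θ ∉ K n}) ∪ ({θ | G θ ∉ Q} ∪ {θ | H θ ∉ Q}) ∪
    ({θ | ENNReal.ofReal ρ ≤ ‖(⇑(U i) - ⇑(W i)) θ‖ₑ} ∪
      {θ | ENNReal.ofReal ρ ≤ ‖(⇑G - ⇑H) θ‖ₑ})
  have hbad : unitMeasure bad ≤ δ := by
    have e : δ = (δ / 6 + δ / 6) + (δ / 6 + δ / 6) + (δ / 6 + δ / 6) := by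
      have := ENNReal.mul_div_cancel (a := 6) (b := δ) (by simp) (by simp)
      calc δ = 6 * (δ / 6) := this.symm
        _ = _ := by ring
    rw [e]
    refine (measure_union_le _ _).trans (add_le_add ((measure_union_le _ _).trans
      (add_le_add ?_ ?_)) ?_)
    · exact (measure_union_le _ _).trans (add_le_add ((hK n _ (hU i)).trans hn')
        ((hK n _ (hW i)).trans hn'))
    · exact (measure_union_le _ _).trans (add_le_add (hQg _ (mem_range_self _))
        (hQg _ (mem_range_self _)))
    · exact (measure_union_le _ _).trans (add_le_add
        (h₁ _ ((Lp.aestronglyMeasurable _).sub (Lp.aestronglyMeasurable _)) hi₁)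
        (h₂ _ ((Lp.aestronglyMeasurable _).sub (Lp.aestronglyMeasurable _)) hi₂))
  -- `bad` need not be measurable; its measurable hull has the same measure.
  set s := toMeasurable unitMeasure bad
  have hs : MeasurableSet s := measurableSet_toMeasurable _ _
  have hsδ : unitMeasure s ≤ δ := (measure_toMeasurable _).trans_le hbad
  have hgood : ∀ᵐ θ ∂unitMeasure,
      ‖sᶜ.indicator (fun θ => f (τ i + θ) (U i θ) - f (σ i + θ) (W i θ)) θ‖ ≤ ε := by
    filter_upwards [ae_unitMeasure_add (hg n) (τ i), ae_unitMeasure_add (hg n) (σ i),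
      (g n).coeFn_bochner (τ i), (g n).coeFn_bochner (σ i)] with θ e1 e2 e3 e4
    by_cases h : θ ∈ s
    · simp [h, hε.le]
    · rw [indicator_of_mem (mem_compl h)]
      have hθ : θ ∉ bad := fun h' => h (subset_toMeasurable _ _ h')
      simp only [bad, mem_union, mem_ofPred_eq, not_or, not_not, not_le, Pi.sub_apply] at hθ
      obtain ⟨⟨⟨c1, c2⟩, c3, c4⟩, c5, c6⟩ := hθ
      rw [← ofReal_norm, ENNReal.ofReal_lt_ofReal_iff hρ, ← dist_eq_norm] at c5 c6
      have := hρε (G θ, ⟨U i θ, c1⟩) ⟨c3, mem_univ _⟩ (H θ, ⟨W i θ, c2⟩) ⟨c4, mem_univ _⟩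
        (by rw [Prod.dist_eq]; exact max_lt c6 c5)
      have e5 : G θ ⟨U i θ, c1⟩ = f (τ i + θ) (U i θ) := by rw [e3]; exact e1 _
      have e6 : H θ ⟨W i θ, c2⟩ = f (σ i + θ) (W i θ) := by rw [e4]; exact e2 _
      simp only [e5, e6, dist_eq_norm] at this
      exact this.le
  have m1 := (hmeas (τ i) (U i)).1
  have m2 := (hmeas (σ i) (W i)).1
  calc eLpNorm (fun θ => f (τ i + θ) (U i θ) - f (σ i + θ) (W i θ)) q unitMeasure
      = eLpNorm ((s.indicator (fun θ => f (τ i + θ) (U i θ)) -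
          s.indicator (fun θ => f (σ i + θ) (W i θ))) +
          sᶜ.indicator (fun θ => f (τ i + θ) (U i θ) - f (σ i + θ) (W i θ))) q unitMeasure := by
        congr 1
        ext θ
        by_cases h : θ ∈ s <;> simp [h]
    _ ≤ (ENNReal.ofReal ε + ENNReal.ofReal ε) + ENNReal.ofReal ε := by
        refine (eLpNorm_add_le ((m1.indicator hs).sub (m2.indicator hs))
          ((m1.sub m2).indicator hs.compl) hq1).trans (add_le_add ?_ ?_)
        · exact (eLpNorm_sub_le (m1.indicator hs) (m2.indicator hs) hq1).trans
            (add_le_add (hui _ _ (hU i) s hs hsδ) (hui _ _ (hW i) s hs hsδ))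
        · exact (eLpNorm_le_of_ae_bound (p := q) hgood).trans (by simp)
    _ = ENNReal.ofReal ε * 3 := by ring
    _ ≤ ε' := hεε'

end Superposition

/-! ### Recurrence as a property of filters on pairs of times -/

section Recurrence

/-- The pull-back of the uniformity of `Z` along `v`, as a filter on pairs of times. -/
def timeUniformity {Z : Type*} [UniformSpace Z] (v : ℝ → Z) : Filter (ℝ × ℝ) :=
  comap (Prod.map v v) (uniformity Z)

theorem tendsto_timeUniformity {Z ι : Type*} [UniformSpace Z] {v : ℝ → Z} {l : Filter ι}
    {τ σ : ι → ℝ} :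
    Tendsto (fun i => (τ i, σ i)) l (timeUniformity v) ↔
      Tendsto (fun i => (v (τ i), v (σ i))) l (uniformity Z) :=
  tendsto_comap_iff

theorem continuous_iff_tendsto_timeUniformity {Z : Type*} [UniformSpace Z] {v : ℝ → Z} :
    Continuous v ↔ ∀ x₀, Tendsto (fun x => (x, x₀)) (𝓝 x₀) (timeUniformity v) := by
  simp only [continuous_iff_continuousAt, ContinuousAt, Uniform.tendsto_nhds_left,
    tendsto_timeUniformity]

/-- The filter generated by the relations `{(t + s, t + s') | c s = c s'}` for the colourings `c`
of the real line with finitely many colours. -/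
def translationFilter : Filter (ℝ × ℝ) where
  sets := {W | ∃ (A : Type) (_ : Finite A) (c : ℝ → A),
    ∀ s s', c s = c s' → ∀ t, (t + s, t + s') ∈ W}
  univ_sets := ⟨Unit, inferInstance, fun _ => (), by simp⟩
  sets_of_superset := by
    rintro W V ⟨A, hA, c, h⟩ hWV
    exact ⟨A, hA, c, fun s s' hs t => hWV (h s s' hs t)⟩
  inter_sets := by
    rintro W V ⟨A, hA, c, h⟩ ⟨A', hA', c', h'⟩
    refine ⟨A × A', inferInstance, fun s => (c s, c' s), fun s s' hs t => ?_⟩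
    exact ⟨h s s' (congrArg Prod.fst hs) t, h' s s' (congrArg Prod.snd hs) t⟩

theorem mem_translationFilter {W : Set (ℝ × ℝ)} :
    W ∈ translationFilter ↔ ∃ (A : Type) (_ : Finite A) (c : ℝ → A),
      ∀ s s', c s = c s' → ∀ t, (t + s, t + s') ∈ W :=
  Iff.rfl

variable {Z : Type*} [NormedAddCommGroup Z] {v : ℝ → Z}

theorem timeUniformity_hasBasis :
    (timeUniformity v).HasBasis (fun ε : ℝ => 0 < ε) fun ε => {z | dist (v z.1) (v z.2) < ε} :=
  Metric.uniformity_basis_dist.comap _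

/-- The translates of an almost periodic function are uniformly precompact. -/
theorem AlmostPeriodic.translationFilter_le (hv : AlmostPeriodic v) :
    translationFilter ≤ timeUniformity v := by
  refine timeUniformity_hasBasis.ge_iff.2 fun ε hε => ?_
  obtain ⟨l, hl, hper⟩ := hv.2 (ε / 6) (by positivity)
  choose T hTper hT using hper
  -- The almost period `T (-s)` lies in `[-s, -s + l]`, so it moves `s` into `[0, l]`. The same
  -- reduction of `t` brings all sums into `[0, 2 * l]`, where `v` is uniformly continuous.
  have hT' : ∀ s t, dist (v (t + (s + T (-s)))) (v (t + s)) ≤ ε / 6 := fun s t => by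
    have := hTper (-s) (t + s)
    rwa [← dist_eq_norm, add_assoc] at this
  have hmem : ∀ s, s + T (-s) ∈ Icc 0 l := fun s => by
    have := hT (-s)
    exact ⟨by linarith [this.1], by linarith [this.2]⟩
  obtain ⟨δ, hδ, huc⟩ := Metric.uniformContinuousOn_iff.1
    ((isCompact_Icc (a := (0 : ℝ)) (b := 2 * l)).uniformContinuousOn_of_continuous
      hv.1.continuousOn) (ε / 6) (by positivity)
  obtain ⟨F, hF, hcov⟩ := Metric.totallyBounded_iff.1
    (isCompact_Icc (a := (0 : ℝ)) (b := l)).totallyBounded (δ / 2) (half_pos hδ)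
  have hex : ∀ s, ∃ y : F, dist (s + T (-s)) y < δ / 2 := fun s => by
    obtain ⟨y, hy, h⟩ := mem_iUnion₂.1 (hcov (hmem s))
    exact ⟨⟨y, hy⟩, h⟩
  -- The colour of `s` is a net point near its reduction to `[0, l]`.
  choose c hc using hex
  refine mem_translationFilter.2 ⟨F, hF, c, fun s s' hss t => ?_⟩
  have hd : dist (s + T (-s)) (s' + T (-s')) < δ := by
    have h1 := hc s
    have h2 := hc s'
    rw [← hss, dist_comm] at h2
    linarith [dist_triangle (s + T (-s)) (c s) (s' + T (-s'))]
  set r := s + T (-s)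
  set r' := s' + T (-s')
  have hr := hmem s
  have hr' := hmem s'
  have ht := hmem t
  have key : ∀ x, dist (v (x + (t + T (-t)))) (v (t + x)) ≤ ε / 6 := fun x => by
    have := hT' t x
    rwa [add_comm x t] at this
  have h1 := huc (r + (t + T (-t))) ⟨by linarith [hr.1, ht.1], by linarith [hr.2, ht.2]⟩
    (r' + (t + T (-t))) ⟨by linarith [hr'.1, ht.1], by linarith [hr'.2, ht.2]⟩ (by simpa using hd)
  have h2 := hT' s t
  have h3 := hT' s' t
  have h4 := key r
  have h5 := key r'
  rw [dist_comm] at h2 h4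
  change dist (v (t + s)) (v (t + s')) < ε
  have := dist_triangle (v (t + s)) (v (t + r)) (v (t + s'))
  have := dist_triangle (v (t + r)) (v (t + r')) (v (t + s'))
  have := dist_triangle4 (v (t + r)) (v (r + (t + T (-t)))) (v (r' + (t + T (-t)))) (v (t + r'))
  linarith

/-- Finitely many colours have representatives in some `[-M, M]`. Subtracting from `α + M` the
representative of its colour gives an almost period in `[α, α + 2 * M]`. -/
theorem almostPeriodic_of_translationFilter_le (hc : Continuous v)
    (h : translationFilter ≤ timeUniformity v) : AlmostPeriodic v := by
  refine ⟨hc, fun ε hε => ?_⟩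
  obtain ⟨A, _, c, hcol⟩ := mem_translationFilter.1 (h (timeUniformity_hasBasis.mem_of_mem hε))
  obtain ⟨M, hM⟩ := (finite_range fun a => |Function.invFun c a|).bddAbove
  have hM' : ∀ a, |Function.invFun c a| ≤ M := fun a => hM (mem_range_self a)
  have hM0 : 0 ≤ M := (abs_nonneg _).trans (hM' (c 0))
  refine ⟨2 * M + 1, by positivity, fun α => ?_⟩
  set s' := Function.invFun c (c (α + M)) with hs'
  have hs : c (α + M) = c s' := (Function.invFun_eq ⟨_, rfl⟩).symm
  have hb := abs_le.1 (hM' (c (α + M)))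
  refine ⟨α + M - s', fun t => ?_, by linarith [hb.2], by linarith [hb.1]⟩
  have := hcol _ _ hs (t - s')
  rw [← dist_eq_norm]
  have e1 : t - s' + (α + M) = t + (α + M - s') := by ring
  simp only [mem_ofPred_eq, e1, sub_add_cancel] at this
  exact this.le

theorem totallyBounded_range_of_translationFilter_le (h : translationFilter ≤ timeUniformity v) :
    TotallyBounded (range v) := by
  refine Metric.totallyBounded_iff.2 fun ε hε => ?_
  obtain ⟨A, _, c, hcol⟩ := mem_translationFilter.1 (h (timeUniformity_hasBasis.mem_of_mem hε))
  refine ⟨range fun a => v (Function.invFun c a), finite_range _, ?_⟩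
  rintro _ ⟨s, rfl⟩
  refine mem_iUnion₂.2 ⟨_, mem_range_self (c s), ?_⟩
  have hs : c s = c (Function.invFun c (c s)) := (Function.invFun_eq ⟨s, rfl⟩).symm
  simpa using hcol _ _ hs 0

/-- Recurrence at time `0` makes the closure of the range sequentially compact: a sequence there is
asymptotic to some `v (s n)`. The limit function supplies the limit, so completeness is not needed.
-/
theorem AlmostAutomorphic.totallyBounded_range (hv : AlmostAutomorphic v) :
    TotallyBounded (range v) := by
  refine TotallyBounded.subset subset_closure (IsSeqCompact.totallyBounded fun x hx => ?_)
  have hex : ∀ n : ℕ, ∃ s, dist (x n) (v s) < 1 / ((n : ℝ) + 1) := fun n => by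
    obtain ⟨_, ⟨s, rfl⟩, hs⟩ := Metric.mem_closure_iff.1 (hx n) _ (Nat.one_div_pos_of_nat (n := n))
    exact ⟨s, hs⟩
  choose s hs using hex
  obtain ⟨φ, hφ, w, hw⟩ := hv.2 s
  have h0 : Tendsto (fun k => v (s (φ k))) atTop (𝓝 (w 0)) := by simpa using (hw 0).1
  have hd : Tendsto (fun k => dist (v (s (φ k))) (x (φ k))) atTop (𝓝 0) := by
    refine squeeze_zero (fun _ => dist_nonneg) (fun k => ?_)
      (tendsto_one_div_add_atTop_nhds_zero_nat.comp hφ.tendsto_atTop)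
    rw [dist_comm]; exact (hs (φ k)).le
  have hlim : Tendsto (x ∘ φ) atTop (𝓝 (w 0)) := (tendsto_iff_of_dist hd).1 h0
  exact ⟨w 0, isClosed_closure.mem_of_tendsto hlim (Eventually.of_forall fun k => hx _), φ, hφ,
    hlim⟩

/-- Recurrence along a sequence of translations, measured by a filter on pairs of times. -/
def AutomorphicAlong (s : ℕ → ℝ) (L : Filter (ℝ × ℝ)) : Prop :=
  (∀ t, Tendsto (fun k : ℕ × ℕ => (t + s k.1, t + s k.2)) (atTop ×ˢ atTop) L) ∧
    ∀ t, Tendsto (fun k : ℕ × ℕ => (t - s k.1 + s k.2, t)) (atTop.curry atTop) L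

theorem AutomorphicAlong.mono {s : ℕ → ℝ} {L L' : Filter (ℝ × ℝ)} (h : AutomorphicAlong s L)
    (hL : L ≤ L') : AutomorphicAlong s L' :=
  ⟨fun t => (h.1 t).mono_right hL, fun t => (h.2 t).mono_right hL⟩

theorem AutomorphicAlong.iInf {ι : Sort*} {s : ℕ → ℝ} {L : ι → Filter (ℝ × ℝ)}
    (h : ∀ i, AutomorphicAlong s (L i)) : AutomorphicAlong s (⨅ i, L i) :=
  ⟨fun t => tendsto_iInf.2 fun i => (h i).1 t, fun t => tendsto_iInf.2 fun i => (h i).2 t⟩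

/-- Shaped for diagonal extraction: the diagonal factors through a given stage only eventually, by
an index map known merely to tend to infinity. -/
theorem AutomorphicAlong.subseq {s s' : ℕ → ℝ} {L : Filter (ℝ × ℝ)} (h : AutomorphicAlong s L)
    {m : ℕ → ℕ} (hm : Tendsto m atTop atTop) (hs : s' =ᶠ[atTop] s ∘ m) :
    AutomorphicAlong s' L := by
  constructor
  · intro t
    refine ((h.1 t).comp (hm.prodMap hm)).congr' ?_
    filter_upwards [hs.prod_inl atTop, hs.prod_inr atTop] with k h1 h2
    simp_all
  · intro t
    refine tendsto_def.2 fun W hW => ?_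
    have := tendsto_def.1 (h.2 t) W hW
    rw [← eventually_mem_set, eventually_curry_iff] at this ⊢
    filter_upwards [hm.eventually this, hs] with k h1 h2
    filter_upwards [hm.eventually h1, hs] with j h3 h4
    simp_all

/-- Extraction of a common subsequence. -/
theorem exists_strictMono_forall_automorphicAlong {L : ℕ → Filter (ℝ × ℝ)}
    (h : ∀ n (s : ℕ → ℝ), ∃ φ : ℕ → ℕ, StrictMono φ ∧ AutomorphicAlong (s ∘ φ) (L n))
    (s : ℕ → ℝ) : ∃ φ : ℕ → ℕ, StrictMono φ ∧ ∀ n, AutomorphicAlong (s ∘ φ) (L n) := by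
  choose ψ hψ hψL using h
  -- `Φ n` composes the first `n` extractions; the diagonal `Φ k k` is the common subsequence.
  let Φ : ℕ → ℕ → ℕ := fun n => Nat.rec id (fun n φ => φ ∘ ψ n (s ∘ φ)) n
  have hΦs : ∀ n, Φ (n + 1) = Φ n ∘ ψ n (s ∘ Φ n) := fun n => rfl
  have hΦ : ∀ n, StrictMono (Φ n) := fun n => by
    induction n with
    | zero => exact strictMono_id
    | succ n ih => exact ih.comp (hψ n _)
  have hfac : ∀ n d, ∃ χ : ℕ → ℕ, StrictMono χ ∧ Φ (n + d) = Φ n ∘ χ := fun n d => by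
    induction d with
    | zero => exact ⟨id, strictMono_id, rfl⟩
    | succ d ih =>
      obtain ⟨χ, hχ, e⟩ := ih
      refine ⟨χ ∘ ψ (n + d) (s ∘ Φ (n + d)), hχ.comp (hψ _ _), ?_⟩
      rw [← add_assoc, hΦs]
      nth_rewrite 1 [e]
      rfl
  refine ⟨fun k => Φ k k, strictMono_nat_of_lt_succ fun k => ?_, fun n => ?_⟩
  · rw [hΦs]
    exact hΦ k ((Nat.lt_succ_self k).trans_le (hψ k _).le_apply)
  · choose χ hχ e using hfac (n + 1)
    refine (hψL n (s ∘ Φ n)).subseq (m := fun k => χ (k - (n + 1)) k)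
      (tendsto_atTop_mono (fun k => (hχ _).le_apply) tendsto_id) ?_
    filter_upwards [eventually_ge_atTop (n + 1)] with k hk
    have := congrFun (e (k - (n + 1))) k
    rw [Nat.add_sub_cancel' hk] at this
    simp only [Function.comp_apply, this]
    rfl

/-- The limit function `w` is eliminated: its existence becomes a Cauchy condition, and `w (t - s
k)` is replaced by `v (t - s k + s j)` for `j` large depending on `k`, whence the curried filter. -/
theorem AlmostAutomorphic.exists_automorphicAlong (hv : AlmostAutomorphic v) (s : ℕ → ℝ) :
    ∃ φ : ℕ → ℕ, StrictMono φ ∧ AutomorphicAlong (s ∘ φ) (timeUniformity v) := by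
  obtain ⟨φ, hφ, w, hw⟩ := hv.2 s
  refine ⟨φ, hφ, fun t => ?_, fun t => ?_⟩
  · rw [tendsto_timeUniformity, prod_atTop_atTop_eq]
    exact cauchySeq_iff_tendsto.1 (hw t).1.cauchySeq
  · refine timeUniformity_hasBasis.tendsto_right_iff.2 fun ε hε => eventually_curry_iff.2 ?_
    filter_upwards [Metric.tendsto_nhds.1 (hw t).2 (ε / 2) (half_pos hε)] with k hk
    filter_upwards [Metric.tendsto_nhds.1 (hw (t - s (φ k))).1 (ε / 2) (half_pos hε)] with j hj
    have := dist_triangle (v (t - s (φ k) + s (φ j))) (w (t - s (φ k))) (v t)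
    exact this.trans_lt (by linarith)

/-- A continuous function that is recurrent for each of countably many filters controlling it is
almost automorphic. -/
theorem almostAutomorphic_of_iInf_le [CompleteSpace Z] {L : ℕ → Filter (ℝ × ℝ)}
    (hc : ∀ n x₀, Tendsto (fun x => (x, x₀)) (𝓝 x₀) (L n))
    (h : ∀ n (s : ℕ → ℝ), ∃ φ : ℕ → ℕ, StrictMono φ ∧ AutomorphicAlong (s ∘ φ) (L n))
    (hle : ⨅ n, L n ≤ timeUniformity v) : AlmostAutomorphic v := by
  refine ⟨continuous_iff_tendsto_timeUniformity.2 fun x₀ =>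
    (tendsto_iInf.2 fun n => hc n x₀).mono_right hle, fun s => ?_⟩
  obtain ⟨φ, hφ, hφL⟩ := exists_strictMono_forall_automorphicAlong h s
  obtain ⟨h1, h2⟩ := (AutomorphicAlong.iInf hφL).mono hle
  have hcau : ∀ t, CauchySeq fun k => v (t + s (φ k)) := fun t => by
    have := h1 t
    rw [tendsto_timeUniformity, prod_atTop_atTop_eq] at this
    exact cauchySeq_iff_tendsto.2 this
  choose w hw using fun t => cauchySeq_tendsto_of_complete (hcau t)
  refine ⟨φ, hφ, w, fun t => ⟨hw t, Metric.tendsto_nhds.2 fun ε hε => ?_⟩⟩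
  have := timeUniformity_hasBasis.tendsto_right_iff.1 (h2 t) (ε / 2) (half_pos hε)
  filter_upwards [eventually_curry_iff.1 this] with k hk
  -- Letting the inner index `j` tend to infinity turns `v (t - s (φ k) + s (φ j))` into `w (t - s
  -- (φ k))`.
  refine (le_of_tendsto ((hw (t - s (φ k))).dist tendsto_const_nhds)
    (hk.mono fun j hj => ?_)).trans_lt (half_lt_self hε)
  exact le_of_lt hj

end Recurrence

/-- A sequence asymptotic to a sequence in a totally bounded set has a totally bounded range. -/
theorem totallyBounded_range_of_tendsto_edist {E : Type*} [PseudoEMetricSpace E] {x y : ℕ → E}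
    {S : Set E} (hS : TotallyBounded S) (hy : ∀ n, y n ∈ S)
    (hxy : Tendsto (fun n => edist (x n) (y n)) atTop (𝓝 0)) : TotallyBounded (range x) := by
  refine EMetric.totallyBounded_iff.2 fun ε hε => ?_
  have hε2 : 0 < ε / 2 := ENNReal.half_pos hε.ne'
  obtain ⟨t, ht, hSt⟩ := EMetric.totallyBounded_iff.1 hS (ε / 2) hε2
  obtain ⟨N, hN⟩ := eventually_atTop.1 (hxy.eventually (gt_mem_nhds hε2))
  refine ⟨t ∪ x '' Iio N, ht.union ((finite_Iio N).image x), ?_⟩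
  rintro _ ⟨n, rfl⟩
  rcases lt_or_ge n N with hn | hn
  · exact mem_iUnion₂.2 ⟨x n, Or.inr ⟨n, hn, rfl⟩, Metric.mem_eball_self hε⟩
  · obtain ⟨z, hz, hyz⟩ := mem_iUnion₂.1 (hSt (hy n))
    refine mem_iUnion₂.2 ⟨z, Or.inl hz, ?_⟩
    rw [Metric.mem_eball] at hyz ⊢
    exact (edist_triangle _ (y n) _).trans_lt
      ((ENNReal.add_lt_add (hN n hn) hyz).trans_eq (ENNReal.add_halves ε))

theorem le_timeUniformity_iff {E : Type*} [PseudoEMetricSpace E] {v : ℝ → E}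
    {l : Filter (ℝ × ℝ)} : l ≤ timeUniformity v ↔
      Tendsto (fun i : ℝ × ℝ => edist (v i.1) (v i.2)) l (𝓝 0) := by
  rw [ENNReal.tendsto_nhds_zero]
  exact (uniformity_basis_edist_le.comap (Prod.map v v)).ge_iff

/-! ### Recurrence and continuity of the superposition operator -/

section Nemytskii

variable {X Y : Type*} [NormedAddCommGroup X] [NormedAddCommGroup Y] {p q : ℝ≥0∞} {f : ℝ → X → Y}

theorem SliceMem.mono {K : TopologicalSpace.Compacts X} {S T : Set (LpLoc q C(K, Y))}
    (h : SliceMem f K S) (hST : S ⊆ T) : SliceMem f K T := by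
  obtain ⟨g, hg, hgf⟩ := h
  exact ⟨g, hST hg, hgf⟩

/-- The superposition operator as a map from `L^p_loc` to `L^q_loc`. -/
def nemytskiiLpLoc (f : ℝ → X → Y)
    (h : ∀ (u : LpLoc p X) (c d : ℝ), MemLp (nemytskii f u) q (volume.restrict (Ioo c d)))
    (u : LpLoc p X) : LpLoc q Y :=
  ⟨nemytskii f u, h u⟩

theorem edist_bochner_nemytskiiLpLoc
    (h : ∀ (u : LpLoc p X) (c d : ℝ), MemLp (nemytskii f u) q (volume.restrict (Ioo c d)))
    (u w : LpLoc p X) (τ σ : ℝ) :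
    edist ((nemytskiiLpLoc f h u).bochner τ) ((nemytskiiLpLoc f h w).bochner σ) =
      eLpNorm (fun θ => f (τ + θ) (u.bochner τ θ) - f (σ + θ) (w.bochner σ θ)) q unitMeasure := by
  unfold LpLoc.bochner
  rw [Lp.edist_toLp_toLp]
  refine eLpNorm_congr_ae ?_
  filter_upwards [u.coeFn_bochner τ, w.coeFn_bochner σ] with θ h1 h2
  change f (τ + θ) (u (τ + θ)) - f (σ + θ) (w (σ + θ)) =
    f (τ + θ) (u.bochner τ θ) - f (σ + θ) (w.bochner σ θ)
  rw [h1, h2]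

variable [Fact (1 ≤ p)] [Fact (1 ≤ q)] {a : ℝ} {b : LpLoc q ℝ} [CompleteSpace X] [CompleteSpace Y]

/-- The times at which the Bochner transform of `f (·, u ·)` is close are controlled by the Bochner
transforms of `u` and of the slices of `f` on a sequence of compact sets. -/
theorem exists_iInf_timeUniformity_le (hp : p ≠ ∞) (hq : q ≠ ∞)
    (hmem : ∀ (u : LpLoc p X) (c d : ℝ), MemLp (nemytskii f u) q (volume.restrict (Ioo c d)))
    (hbr : b ∈ PrecompactRange q ℝ)
    (hb : ∀ x, ∀ᵐ t, ‖f t x‖ ≤ a * ‖x‖ ^ (p.toReal / q.toReal) + b t)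
    {g : ∀ K : TopologicalSpace.Compacts X, LpLoc q C(K, Y)}
    (hgr : ∀ K : TopologicalSpace.Compacts X, g K ∈ PrecompactRange q C(K, Y))
    (hg : ∀ K : TopologicalSpace.Compacts X, ∀ᵐ t, ∀ x : K, (g K).toFun t x = f t x)
    {u : LpLoc p X} (hu : u ∈ PrecompactRange p X) :
    ∃ K : ℕ → TopologicalSpace.Compacts X,
      ⨅ n : ℕ, (Nat.rec (timeUniformity u.bochner)
        (fun n _ => timeUniformity (g (K n)).bochner) n : Filter (ℝ × ℝ)) ≤
      timeUniformity (nemytskiiLpLoc f hmem u).bochner := by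
  have hK : ∀ n : ℕ, ∃ K : TopologicalSpace.Compacts X,
      ∀ v ∈ range u.bochner, unitMeasure {θ | v θ ∉ K} ≤ ((n : ℝ≥0∞) + 1)⁻¹ := fun n => by
    obtain ⟨K, hK, h⟩ := exists_isCompact_measure_notMem_le hp hu
      (δ := ((n : ℝ≥0∞) + 1)⁻¹) (by simp)
    exact ⟨⟨K, hK⟩, h⟩
  choose K hK using hK
  refine ⟨K, ?_⟩
  -- Index `0` carries `u` and index `n + 1` the slice on `K n`, so that one countable family holds
  -- all the data.
  set L : ℕ → Filter (ℝ × ℝ) := fun n => Nat.rec (timeUniformity u.bochner)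
        (fun n _ => timeUniformity (g (K n)).bochner) n
  have key := tendsto_eLpNorm_superposition_sub hp hq (fun K => ⟨g K, mem_univ _, hg K⟩) hbr hb hu
    hK (fun n => hgr (K n)) (fun n => hg (K n)) (l := ⨅ n, L n) (τ := Prod.fst) (σ := Prod.snd)
    (U := fun i => u.bochner i.1) (W := fun i => u.bochner i.2) (fun i => mem_range_self _)
    (fun i => mem_range_self _) (le_timeUniformity_iff.1 (iInf_le L 0))
    (fun n => le_timeUniformity_iff.1 (iInf_le L (n + 1)))
  simp only [← edist_bochner_nemytskiiLpLoc hmem] at key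
  exact le_timeUniformity_iff.2 key

/-- Sequential continuity of the superposition operator for the Stepanov distance. -/
theorem tendsto_edist_nemytskiiLpLoc (hp : p ≠ ∞) (hq : q ≠ ∞)
    (hmem : ∀ (u : LpLoc p X) (c d : ℝ), MemLp (nemytskii f u) q (volume.restrict (Ioo c d)))
    (hbr : b ∈ PrecompactRange q ℝ)
    (hb : ∀ x, ∀ᵐ t, ‖f t x‖ ≤ a * ‖x‖ ^ (p.toReal / q.toReal) + b t)
    (hf : ∀ K : TopologicalSpace.Compacts X, SliceMem f K (PrecompactRange q C(K, Y)))
    {u : LpLoc p X} (hu : u ∈ PrecompactRange p X) {w : ℕ → LpLoc p X}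
    (hw : Tendsto (fun n => edist (w n) u) atTop (𝓝 0)) :
    Tendsto (fun n => edist (nemytskiiLpLoc f hmem (w n)) (nemytskiiLpLoc f hmem u)) atTop
      (𝓝 0) := by
  -- Uniformity in time is obtained by letting the time vary with `n`. As `w n` tends to `u`, the
  -- values at `t n` together with the range of `u.bochner` remain totally bounded.
  have hpt : ∀ t : ℕ → ℝ, Tendsto (fun n => edist ((nemytskiiLpLoc f hmem (w n)).bochner (t n))
      ((nemytskiiLpLoc f hmem u).bochner (t n))) atTop (𝓝 0) := fun t => by
    have hwt : Tendsto (fun n => edist ((w n).bochner (t n)) (u.bochner (t n))) atTop (𝓝 0) :=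
      tendsto_of_tendsto_of_tendsto_of_le_of_le tendsto_const_nhds hw (fun _ => zero_le)
        fun n => le_iSup (fun t => edist ((w n).bochner t) (u.bochner t)) (t n)
    set S := range (fun n => (w n).bochner (t n)) ∪ range u.bochner
    have hS : TotallyBounded S :=
      (totallyBounded_range_of_tendsto_edist hu (fun n => mem_range_self (t n)) hwt).union hu
    have hK : ∀ n : ℕ, ∃ K : TopologicalSpace.Compacts X,
        ∀ v ∈ S, unitMeasure {θ | v θ ∉ K} ≤ ((n : ℝ≥0∞) + 1)⁻¹ := fun n => by
      obtain ⟨K, hK, h⟩ := exists_isCompact_measure_notMem_le hp hS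
        (δ := ((n : ℝ≥0∞) + 1)⁻¹) (by simp)
      exact ⟨⟨K, hK⟩, h⟩
    choose K hK using hK
    choose g hgr hg using fun n => hf (K n)
    have key := tendsto_eLpNorm_superposition_sub hp hq (fun K => (hf K).mono (subset_univ _)) hbr
      hb hS hK hgr hg (l := atTop) (τ := t) (σ := t) (fun n => Or.inl (mem_range_self n))
      (fun n => Or.inr (mem_range_self (t n))) hwt (fun n => by simp)
    simpa only [← edist_bochner_nemytskiiLpLoc hmem] using key
  refine ENNReal.tendsto_nhds_zero.2 fun ε hε => ?_
  -- If the supremum exceeds `ε`, some time witnesses it; otherwise the time is irrelevant and `0`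
  -- serves.
  have hex : ∀ n, ∃ t, ε < edist (nemytskiiLpLoc f hmem (w n)) (nemytskiiLpLoc f hmem u) →
      ε < edist ((nemytskiiLpLoc f hmem (w n)).bochner t)
        ((nemytskiiLpLoc f hmem u).bochner t) := fun n => by
    by_cases h : ε < edist (nemytskiiLpLoc f hmem (w n)) (nemytskiiLpLoc f hmem u)
    · obtain ⟨t, ht⟩ := lt_iSup_iff.1 h
      exact ⟨t, fun _ => ht⟩
    · exact ⟨0, fun h' => (h h').elim⟩
  choose t ht using hex
  filter_upwards [ENNReal.tendsto_nhds_zero.1 (hpt t) ε hε] with n hn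
  by_contra h
  exact (ht n (not_le.1 h)).not_ge hn

/-- A superposition operator with precompact slices that maps a set of functions with precompact
range into another set does so continuously. -/
theorem nemytskiiMapsContinuously_of_mem (hp : p ≠ ∞) (hq : q ≠ ∞)
    (hmem : ∀ (u : LpLoc p X) (c d : ℝ), MemLp (nemytskii f u) q (volume.restrict (Ioo c d)))
    (hbr : b ∈ PrecompactRange q ℝ)
    (hb : ∀ x, ∀ᵐ t, ‖f t x‖ ≤ a * ‖x‖ ^ (p.toReal / q.toReal) + b t)
    (hf : ∀ K : TopologicalSpace.Compacts X, SliceMem f K (PrecompactRange q C(K, Y)))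
    {A : Set (LpLoc p X)} {B : Set (LpLoc q Y)} (hA : A ⊆ PrecompactRange p X)
    (hAB : ∀ u ∈ A, nemytskiiLpLoc f hmem u ∈ B) : NemytskiiMapsContinuously f A B := by
  refine ⟨fun u => ⟨nemytskiiLpLoc f hmem u, hAB u u.2⟩, fun u => rfl, ?_⟩
  refine continuous_iff_continuousAt.2 fun u => tendsto_of_seq_tendsto fun w hw => ?_
  rw [tendsto_subtype_rng, tendsto_iff_edist_tendsto_0] at hw ⊢
  exact tendsto_edist_nemytskiiLpLoc hp hq hmem hbr hb hf (hA u.2) hw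

end Nemytskii

theorem Saa_subset_precompactRange {p : ℝ≥0∞} [Fact (1 ≤ p)] {E : Type*} [NormedAddCommGroup E] :
    Saa p E ⊆ PrecompactRange p E :=
  fun _ hu => AlmostAutomorphic.totallyBounded_range hu

theorem Sap_subset_precompactRange {p : ℝ≥0∞} [Fact (1 ≤ p)] {E : Type*} [NormedAddCommGroup E] :
    Sap p E ⊆ PrecompactRange p E :=
  fun _ hu => totallyBounded_range_of_translationFilter_le (AlmostPeriodic.translationFilter_le hu)

end Stepanov

/-! ### The theorem -/

theorem mainTheorem3 {X Y : Type*}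
    [NormedAddCommGroup X] [NormedSpace ℝ X] [CompleteSpace X]
    [NormedAddCommGroup Y] [NormedSpace ℝ Y] [CompleteSpace Y]
    (p q : ℝ≥0∞) [Fact (1 ≤ p)] [Fact (1 ≤ q)] (hp : p ≠ ∞) (hq : q ≠ ∞)
    (f : ℝ → X → Y)
    (H1 : ∃ a : ℝ, 0 < a ∧ ∃ b ∈ Stepanov.Saa q ℝ,
      ∀ x : X, ∀ᵐ t : ℝ, ‖f t x‖ ≤ a * ‖x‖ ^ (p.toReal / q.toReal) + b.toFun t) :
    ((∀ K : TopologicalSpace.Compacts X, Stepanov.SliceMem f K (Stepanov.Saa q C(K, Y))) →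
      Stepanov.NemytskiiMapsContinuously f (Stepanov.Saa p X) (Stepanov.Saa q Y)) ∧
    ((∀ K : TopologicalSpace.Compacts X, Stepanov.SliceMem f K (Stepanov.Sap q C(K, Y))) →
      Stepanov.NemytskiiMapsContinuously f (Stepanov.Sap p X) (Stepanov.Sap q Y)) := by
  open Stepanov in
  obtain ⟨a, -, b, hb, hfb⟩ := H1
  -- Beyond the growth bound, only this total boundedness of `b` matters, so an almost automorphic
  -- `b` suffices in the almost periodic case too.
  have hbr := Saa_subset_precompactRange hb
  constructor
  · intro hf
    have hmem := memLp_nemytskii hp hq (fun K => (hf K).mono (subset_univ _)) hfb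
    refine nemytskiiMapsContinuously_of_mem hp hq hmem hbr hfb
      (fun K => (hf K).mono Saa_subset_precompactRange) Saa_subset_precompactRange fun u hu => ?_
    choose g hgs hg using hf
    obtain ⟨K, hK⟩ := exists_iInf_timeUniformity_le hp hq hmem hbr hfb
      (fun K : TopologicalSpace.Compacts X => Saa_subset_precompactRange (hgs K)) hg (Saa_subset_precompactRange hu)
    refine almostAutomorphic_of_iInf_le (fun n => ?_) (fun n => ?_) hK
    · cases n with
      | zero => exact continuous_iff_tendsto_timeUniformity.1 hu.1
      | succ n => exact continuous_iff_tendsto_timeUniformity.1 (hgs (K n)).1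
    · cases n with
      | zero => exact AlmostAutomorphic.exists_automorphicAlong hu
      | succ n => exact AlmostAutomorphic.exists_automorphicAlong (hgs (K n))
  · intro hf
    have hmem := memLp_nemytskii hp hq (fun K => (hf K).mono (subset_univ _)) hfb
    refine nemytskiiMapsContinuously_of_mem hp hq hmem hbr hfb
      (fun K => (hf K).mono Sap_subset_precompactRange) Sap_subset_precompactRange fun u hu => ?_
    choose g hgs hg using hf
    obtain ⟨K, hK⟩ := exists_iInf_timeUniformity_le hp hq hmem hbr hfb
      (fun K : TopologicalSpace.Compacts X => Sap_subset_precompactRange (hgs K)) hg (Sap_subset_precompactRange hu)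
    refine almostPeriodic_of_translationFilter_le ?_ (le_trans (le_iInf fun n => ?_) hK)
    · refine continuous_iff_tendsto_timeUniformity.2 fun x₀ =>
        (tendsto_iInf.2 fun n => ?_).mono_right hK
      cases n with
      | zero => exact continuous_iff_tendsto_timeUniformity.1 hu.1 x₀
      | succ n => exact continuous_iff_tendsto_timeUniformity.1 (hgs (K n)).1 x₀
    · cases n with
      | zero => exact AlmostPeriodic.translationFilter_le hu
      | succ n => exact AlmostPeriodic.translationFilter_le (hgs (K n))
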